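/- Let $p$ be a prime. Let $\mathbb{H}_p$ be the quaternion algebra over $\mathbb{Q}_p$ with basis $1,\mathbf i,\mathbf j,\mathbf k$, where $\mathbf i^2=a$, $\mathbf j^2=b$, $\mathbf i\mathbf j=-\mathbf j\mathbf i$: if $p=2$, then $a=b=-1$ and $\mathbf k=\mathbf i\mathbf j$; if $p>2$, then $a=v$ is a $p$-adic unit that is not a square, $b=-p$ and $\mathbf k=\mathbf j\mathbf i$. Let $\mathrm{nrd}(\xi)=\xi\overline{\xi}$ be the reduced norm; in the coordinates of the basis it is the quadratic form $Q_{(4)}(x)=x_0^2-ax_1^2-bx_2^2+ab\,x_3^2$, that is, $x_0^2+x_1^2+x_2^2+x_3^2$ for $p=2$ and $x_0^2-vx_1^2+px_2^2-pvx_3^2$ for $p>2$. Let $A$ be the (diagonal) matrix of $Q_{(4)}$ and $$\mathrm{SO}(4,\mathbb{Q}_p)=\{L\in \mathsf{M}_4(\mathbb{Q}_p)\mid L^\top A L=A,\ \det L=1\},\qquad \mathbb{P}(\mathbb{H}_p^\times)=\{(\xi,\varrho)\in\mathbb{H}_p^\times\times\mathbb{H}_p^\times\mid \mathrm{nrd}(\xi)=\mathrm{nrd}(\varrho)\},$$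 with their $p$-adic topologies. Embed $\mathbb{Q}_p^\times$ diagonally in $\mathbb{P}(\mathbb{H}_p^\times)$, let $X=\mathbb{P}(\mathbb{H}_p^\times)/\mathbb{Q}_p^\times$ with quotient map $q$, and let $\bar\kappa\colon X\to\mathrm{SO}(4,\mathbb{Q}_p)$ be the homomorphism that sends the class of $(\xi,\varrho)$ to the matrix of $\eta\mapsto\xi\eta\varrho^{-1}$ in the basis $1,\mathbf i,\mathbf j,\mathbf k$ of $\mathbb{H}_p$. Let $\nu$, $\mu_4$, $\mu_{\mathbb{P}}$ be any Haar measures on $\mathbb{Q}_p^\times$, $\mathrm{SO}(4,\mathbb{Q}_p)$ and $\mathbb{P}(\mathbb{H}_p^\times)$. Let $\Psi$ be the set of all continuous compactly supported functions $\psi\colon\mathbb{P}(\mathbb{H}_p^\times)\to[0,\infty)$, not identically zero, such that $$(P\psi)(x)=\int_{\mathbb{Q}_p^\times}\psi(\mathtt{s}(x)\alpha)\,\mathrm{d}\nu(\alpha)=1\qquad\text{for all }x\in X,$$ where $\mathtt{s}(x)$ is any representative of $x$ (the value does not depend on it). For $\psi\in\Psi$ and $\phi\in\mathrm{L}^1(\mathrm{SO}(4,\mathbb{Q}_p),\mu_4)$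 let the extended Weil–Mackey–Bruhat lift of $\phi$ be $$(\widehat{\mathscr{L}}_\psi\phi)(g)=\psi(g)\,\phi\big(\bar\kappa(q(g))\big),\qquad g\in\mathbb{P}(\mathbb{H}_p^\times).$$ Then $\Psi$ is not empty, and there is a constant $c>0$ such that, after $\mu_{\mathbb{P}}$ is replaced by the Haar measure $c\,\mu_{\mathbb{P}}$, for every $\psi\in\Psi$ and every $\phi\in\mathrm{L}^1(\mathrm{SO}(4,\mathbb{Q}_p),\mu_4)$ one has $\widehat{\mathscr{L}}_\psi\phi\in\mathrm{L}^1(\mathbb{P}(\mathbb{H}_p^\times),c\,\mu_{\mathbb{P}})$ and $$\int_{\mathrm{SO}(4,\mathbb{Q}_p)}\phi(R)\,\mathrm{d}\mu_4(R)=\int_{\mathbb{P}(\mathbb{H}_p^\times)}(\widehat{\mathscr{L}}_\psi\phi)(g)\,\mathrm{d}(c\,\mu_{\mathbb{P}})(g).$$ -/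

import Mathlib

open MeasureTheory
open scoped Quaternion NNReal

noncomputable section

/-! ### Weil-Mackey-Bruhat lifts for a quotient group `G ⧸ N` -/

section WMB

/-- The map `(P f)(x) = ∫_N f(s(x) h) dν(h)` on `G ⧸ N`, where `s` is a section of `G → G ⧸ N`.
For a left-invariant `ν` the value does not depend on the representative `s(x)` of `x`, see
`weilMap_mk`. -/
def weilMap {G : Type*} [Group G] {N : Subgroup G} [MeasurableSpace N] (ν : Measure N)
    {E : Type*} [NormedAddCommGroup E] [NormedSpace ℝ E] (f : G → E) (x : G ⧸ N) : E :=
  ∫ h : N, f (x.out * (h : G)) ∂ν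

theorem weilMap_mk {G : Type*} [Group G] {N : Subgroup G} [MeasurableSpace N] [MeasurableMul N]
    (ν : Measure N) [ν.IsMulLeftInvariant]
    {E : Type*} [NormedAddCommGroup E] [NormedSpace ℝ E] (f : G → E) (g : G) :
    weilMap ν f (QuotientGroup.mk g : G ⧸ N) = ∫ h : N, f (g * (h : G)) ∂ν := by
  obtain ⟨n, hn⟩ := QuotientGroup.mk_out_eq_mul N g
  unfold weilMap
  rw [hn, ← integral_mul_left_eq_self (fun h : N => f (g * (h : G))) n]
  simp [mul_assoc]

/-- The set `Ψ` of the functions `ψ ∈ C_c⁺(G)` (continuous, compactly supported, nonnegative, not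
identically zero) with `P ψ = 1` on all of `G ⧸ N`. -/
def wmbWeights {G : Type*} [Group G] [TopologicalSpace G] {N : Subgroup G} [MeasurableSpace N]
    (ν : Measure N) : Set (G → ℝ) :=
  {ψ | Continuous ψ ∧ HasCompactSupport ψ ∧ (∀ g, 0 ≤ ψ g) ∧ ψ ≠ 0 ∧
    ∀ x : G ⧸ N, weilMap ν ψ x = 1}

/-- The (extended) Weil-Mackey-Bruhat lift `g ↦ ψ(g) φ(q(g))` of a function `φ` on `G ⧸ N`,
`q` being the quotient map. -/
def wmbLift {G : Type*} [Group G] {N : Subgroup G} (ψ : G → ℝ) (φ : G ⧸ N → ℂ) (g : G) : ℂ :=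
  (ψ g : ℂ) * φ (QuotientGroup.mk g)

end WMB

/-! ### The `p`-adic quaternion algebra -/

/-- The squares `a = i²` and `b = j²` in the `p`-adic quaternion algebra: `a = b = -1` if `p = 2`;
if `p` is odd, then `a` is a nonsquare `p`-adic unit and `b = -p`. -/
def IsQuatParam (p : ℕ) [Fact p.Prime] (a b : ℚ_[p]) : Prop :=
  (p = 2 ∧ a = -1 ∧ b = -1) ∨ (p ≠ 2 ∧ ‖a‖ = 1 ∧ ¬ IsSquare a ∧ b = -(p : ℚ_[p]))

/-- The quaternion algebra over `ℚ_p` with `i² = a`, `j² = b`, `i j = - j i`. -/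
abbrev PQuat (p : ℕ) [Fact p.Prime] (a b : ℚ_[p]) : Type := ℍ[ℚ_[p], a, 0, b]

/-- The `p`-adic topology of `ℍ_p ≅ ℚ_p⁴`. The unit group `(ℍ_p)ˣ` carries the topology of units
of Mathlib. -/
instance PQuat.instTopologicalSpace (p : ℕ) [Fact p.Prime] (a b : ℚ_[p]) :
    TopologicalSpace (PQuat p a b) :=
  TopologicalSpace.induced (QuaternionAlgebra.equivTuple a 0 b) inferInstance

/-- The basis vector `k` is `i j` for `p = 2` and `j i = - i j` for odd `p`; this is its coordinate
with respect to `i j`. -/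
def quatKSign (p : ℕ) [Fact p.Prime] : ℚ_[p] := if p = 2 then 1 else -1

theorem quatKSign_mul_self (p : ℕ) [Fact p.Prime] : quatKSign p * quatKSign p = 1 := by
  unfold quatKSign; split_ifs <;> norm_num

/-- The coordinates of a quaternion in the basis `1, i, j, k`, see `quatCoord_symm`. -/
def quatCoord (p : ℕ) [Fact p.Prime] (a b : ℚ_[p]) : PQuat p a b ≃ₗ[ℚ_[p]] (Fin 4 → ℚ_[p]) where
  toFun x := ![x.re, x.imI, x.imJ, quatKSign p * x.imK]
  invFun q := ⟨q 0, q 1, q 2, quatKSign p * q 3⟩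
  map_add' x y := by ext i; fin_cases i <;> simp [mul_add]
  map_smul' c x := by ext i; fin_cases i <;> simp; ring
  left_inv x := by ext <;> simp [← mul_assoc, quatKSign_mul_self]
  right_inv q := by ext i; fin_cases i <;> simp [← mul_assoc, quatKSign_mul_self]

theorem quatCoord_symm (p : ℕ) [Fact p.Prime] (a b : ℚ_[p]) (q : Fin 4 → ℚ_[p]) :
    let i : PQuat p a b := ⟨0, 1, 0, 0⟩
    let j : PQuat p a b := ⟨0, 0, 1, 0⟩
    let k : PQuat p a b := if p = 2 then i * j else j * i
    (quatCoord p a b).symm q = q 0 • 1 + q 1 • i + q 2 • j + q 3 • k := by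
  intro i j k
  by_cases hp : p = 2 <;> ext <;> simp [i, j, k, quatCoord, quatKSign, hp]

/-- The reduced norm `nrd ξ = ξ ξ̄ ∈ ℚ_p`, see `coe_nrd`. -/
def nrd (p : ℕ) [Fact p.Prime] (a b : ℚ_[p]) (x : PQuat p a b) : ℚ_[p] := (x * star x).re

theorem coe_nrd (p : ℕ) [Fact p.Prime] (a b : ℚ_[p]) (x : PQuat p a b) :
    ((nrd p a b x : ℚ_[p]) : PQuat p a b) = x * star x := by
  ext <;> simp [nrd] <;> ring

theorem nrd_one (p : ℕ) [Fact p.Prime] (a b : ℚ_[p]) : nrd p a b 1 = 1 := by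
  simp [nrd]

theorem nrd_mul (p : ℕ) [Fact p.Prime] (a b : ℚ_[p]) (x y : PQuat p a b) :
    nrd p a b (x * y) = nrd p a b x * nrd p a b y := by
  simp [nrd]; ring

theorem nrd_mul_nrd_inv (p : ℕ) [Fact p.Prime] (a b : ℚ_[p]) (x : (PQuat p a b)ˣ) :
    nrd p a b x * nrd p a b (x⁻¹ : (PQuat p a b)ˣ) = 1 := by
  rw [← nrd_mul, Units.mul_inv, nrd_one]

/-! ### The group of pairs of quaternions of equal reduced norm -/

/-- The group `P(ℍ_pˣ)` of the pairs `(ξ, ρ)` of invertible quaternions with `nrd ξ = nrd ρ`. -/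
def quatPairs (p : ℕ) [Fact p.Prime] (a b : ℚ_[p]) :
    Subgroup ((PQuat p a b)ˣ × (PQuat p a b)ˣ) where
  carrier := {x | nrd p a b x.1 = nrd p a b x.2}
  one_mem' := rfl
  mul_mem' {x y} hx hy := by
    simp only [Set.mem_ofPred_eq] at hx hy ⊢
    simp only [Prod.fst_mul, Prod.snd_mul, Units.val_mul, nrd_mul, hx, hy]
  inv_mem' {x} hx := by
    simp only [Set.mem_ofPred_eq] at hx ⊢
    have h1 := nrd_mul_nrd_inv p a b x.1
    have h2 := nrd_mul_nrd_inv p a b x.2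
    rw [hx] at h1
    exact mul_left_cancel₀ (left_ne_zero_of_mul_eq_one h2) (h1.trans h2.symm)

instance quatPairs.instMeasurableSpace (p : ℕ) [Fact p.Prime] (a b : ℚ_[p]) :
    MeasurableSpace (quatPairs p a b) := borel _

instance quatPairs.instBorelSpace (p : ℕ) [Fact p.Prime] (a b : ℚ_[p]) :
    BorelSpace (quatPairs p a b) := ⟨rfl⟩

/-- The diagonal copy `{(α, α) | α ∈ ℚ_pˣ}` of `ℚ_pˣ` in `P(ℍ_pˣ)`. -/
def scalarPairs (p : ℕ) [Fact p.Prime] (a b : ℚ_[p]) : Subgroup (quatPairs p a b) where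
  carrier := {x | ∃ α : ℚ_[p]ˣ, (x.1.1 : PQuat p a b) = ((α : ℚ_[p]) : PQuat p a b) ∧
    (x.1.2 : PQuat p a b) = ((α : ℚ_[p]) : PQuat p a b)}
  one_mem' := ⟨1, by simp⟩
  mul_mem' := by
    rintro x y ⟨α, h1, h2⟩ ⟨β, h3, h4⟩
    exact ⟨α * β, by simp [h1, h3], by simp [h2, h4]⟩
  inv_mem' := by
    rintro x ⟨α, h1, h2⟩
    have key : ((α : ℚ_[p]) : PQuat p a b) * (((α⁻¹ : ℚ_[p]ˣ) : ℚ_[p]) : PQuat p a b) = 1 := by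
      rw [← QuaternionAlgebra.coe_mul, Units.mul_inv, QuaternionAlgebra.coe_one]
    refine ⟨α⁻¹, ?_, ?_⟩
    · change ((x.1.1⁻¹ : (PQuat p a b)ˣ) : PQuat p a b) = _
      exact Units.inv_eq_of_mul_eq_one_right (by rw [h1, key])
    · change ((x.1.2⁻¹ : (PQuat p a b)ˣ) : PQuat p a b) = _
      exact Units.inv_eq_of_mul_eq_one_right (by rw [h2, key])

instance scalarPairs.instNormal (p : ℕ) [Fact p.Prime] (a b : ℚ_[p]) :
    (scalarPairs p a b).Normal where
  conj_mem := by
    rintro n ⟨α, h1, h2⟩ g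
    refine ⟨α, ?_, ?_⟩
    · change ((g.1.1 * n.1.1 * g.1.1⁻¹ : (PQuat p a b)ˣ) : PQuat p a b) = _
      rw [Units.val_mul, Units.val_mul, h1, ← QuaternionAlgebra.coe_commutes, mul_assoc,
        Units.mul_inv, mul_one]
    · change ((g.1.2 * n.1.2 * g.1.2⁻¹ : (PQuat p a b)ˣ) : PQuat p a b) = _
      rw [Units.val_mul, Units.val_mul, h2, ← QuaternionAlgebra.coe_commutes, mul_assoc,
        Units.mul_inv, mul_one]

/-! ### The special orthogonal group in dimension four -/

/-- The matrix of the quadratic form `Q₍₄₎(x) = x₀² - a x₁² - b x₂² + a b x₃²`. With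
`IsQuatParam p a b` this is `x₀² + x₁² + x₂² + x₃²` for `p = 2` and
`x₀² - a x₁² + p x₂² - p a x₃²` for odd `p`. -/
def quatFormMatrix (p : ℕ) [Fact p.Prime] (a b : ℚ_[p]) : Matrix (Fin 4) (Fin 4) ℚ_[p] :=
  Matrix.diagonal ![1, -a, -b, a * b]

/-- `SO(4, ℚ_p) = {L ∈ M₄(ℚ_p) | Lᵀ A L = A, det L = 1}`, with the topology of `M₄(ℚ_p)`. -/
def SO4 (p : ℕ) [Fact p.Prime] (a b : ℚ_[p]) :
    Subgroup (Matrix.SpecialLinearGroup (Fin 4) ℚ_[p]) where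
  carrier := {L | (L.1.transpose * quatFormMatrix p a b * L.1) = quatFormMatrix p a b}
  one_mem' := by simp
  mul_mem' {L M} hL hM := by
    simp only [Set.mem_ofPred_eq] at hL hM ⊢
    calc _ = M.1.transpose * (L.1.transpose * quatFormMatrix p a b * L.1) * M.1 := by
          simp [Matrix.transpose_mul, Matrix.mul_assoc]
      _ = _ := by rw [hL, hM]
  inv_mem' {L} hL := by
    simp only [Set.mem_ofPred_eq] at hL ⊢
    have h : L.1 * (L⁻¹).1 = 1 := by
      rw [← Matrix.SpecialLinearGroup.coe_mul, mul_inv_cancel, Matrix.SpecialLinearGroup.coe_one]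
    have h' : (L⁻¹).1.transpose * L.1.transpose = 1 := by
      rw [← Matrix.transpose_mul, h, Matrix.transpose_one]
    calc _ = (L⁻¹).1.transpose * (L.1.transpose * quatFormMatrix p a b * L.1) * (L⁻¹).1 := by
          rw [hL]
      _ = ((L⁻¹).1.transpose * L.1.transpose) * quatFormMatrix p a b * (L.1 * (L⁻¹).1) := by
          simp only [Matrix.mul_assoc]
      _ = _ := by rw [h, h', one_mul, mul_one]

instance SO4.instMeasurableSpace (p : ℕ) [Fact p.Prime] (a b : ℚ_[p]) :
    MeasurableSpace (SO4 p a b) := borel _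

instance SO4.instBorelSpace (p : ℕ) [Fact p.Prime] (a b : ℚ_[p]) :
    BorelSpace (SO4 p a b) := ⟨rfl⟩

/-! ### The identification of `P(ℍ_pˣ) / ℚ_pˣ` with `SO(4, ℚ_p)` -/

/-- The map `η ↦ ξ η ρ⁻¹` on `ℍ_p`, in the coordinates with respect to `1, i, j, k`. -/
def pairLin (p : ℕ) [Fact p.Prime] (a b : ℚ_[p]) (x : (PQuat p a b)ˣ × (PQuat p a b)ˣ) :
    (Fin 4 → ℚ_[p]) →ₗ[ℚ_[p]] (Fin 4 → ℚ_[p]) :=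
  (quatCoord p a b).toLinearMap ∘ₗ
    (LinearMap.mulLeft ℚ_[p] (x.1 : PQuat p a b) ∘ₗ
      LinearMap.mulRight ℚ_[p] ((x.2⁻¹ : (PQuat p a b)ˣ) : PQuat p a b)) ∘ₗ
    (quatCoord p a b).symm.toLinearMap

theorem pairLin_apply (p : ℕ) [Fact p.Prime] (a b : ℚ_[p])
    (x : (PQuat p a b)ˣ × (PQuat p a b)ˣ) (η : PQuat p a b) :
    pairLin p a b x (quatCoord p a b η) =
      quatCoord p a b (x.1 * η * ((x.2⁻¹ : (PQuat p a b)ˣ) : PQuat p a b)) := by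
  simp [pairLin, mul_assoc]

theorem pairLin_one (p : ℕ) [Fact p.Prime] (a b : ℚ_[p]) : pairLin p a b 1 = LinearMap.id := by
  ext1 i
  ext1
  simp [pairLin]

theorem pairLin_mul (p : ℕ) [Fact p.Prime] (a b : ℚ_[p])
    (x y : (PQuat p a b)ˣ × (PQuat p a b)ˣ) :
    pairLin p a b (x * y) = pairLin p a b x ∘ₗ pairLin p a b y := by
  refine LinearMap.ext fun q => ?_
  simp [pairLin, mul_assoc]

theorem basisOneIJK_eq (p : ℕ) [Fact p.Prime] (a b : ℚ_[p]) (c : Fin 4) :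
    QuaternionAlgebra.basisOneIJK a 0 b c =
      (⟨(Pi.single c 1 : Fin 4 → ℚ_[p]) 0, (Pi.single c 1 : Fin 4 → ℚ_[p]) 1,
        (Pi.single c 1 : Fin 4 → ℚ_[p]) 2, (Pi.single c 1 : Fin 4 → ℚ_[p]) 3⟩ :
          PQuat p a b) := by
  rw [QuaternionAlgebra.basisOneIJK, Module.Basis.coe_ofEquivFun]
  rfl

theorem det_mulLeft_quat (p : ℕ) [Fact p.Prime] (a b : ℚ_[p]) (x : PQuat p a b) :
    LinearMap.det (LinearMap.mulLeft ℚ_[p] x) = nrd p a b x ^ 2 := by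
  rw [← LinearMap.det_toMatrix (QuaternionAlgebra.basisOneIJK a 0 b)]
  have h : LinearMap.toMatrix (QuaternionAlgebra.basisOneIJK a 0 b)
      (QuaternionAlgebra.basisOneIJK a 0 b) (LinearMap.mulLeft ℚ_[p] x) =
      !![x.re, a * x.imI, b * x.imJ, -(a * b * x.imK);
        x.imI, x.re, b * x.imK, -(b * x.imJ);
        x.imJ, -(a * x.imK), x.re, a * x.imI;
        x.imK, -x.imJ, x.imI, x.re] := by
    ext r c
    rw [LinearMap.toMatrix_apply, QuaternionAlgebra.coe_basisOneIJK_repr, basisOneIJK_eq]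
    fin_cases c <;> fin_cases r <;> simp
  rw [h]
  simp [Matrix.det_succ_row_zero, Fin.sum_univ_succ, Fin.succAbove, nrd]
  ring

theorem det_mulRight_quat (p : ℕ) [Fact p.Prime] (a b : ℚ_[p]) (x : PQuat p a b) :
    LinearMap.det (LinearMap.mulRight ℚ_[p] x) = nrd p a b x ^ 2 := by
  rw [← LinearMap.det_toMatrix (QuaternionAlgebra.basisOneIJK a 0 b)]
  have h : LinearMap.toMatrix (QuaternionAlgebra.basisOneIJK a 0 b)
      (QuaternionAlgebra.basisOneIJK a 0 b) (LinearMap.mulRight ℚ_[p] x) =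
      !![x.re, a * x.imI, b * x.imJ, -(a * b * x.imK);
        x.imI, x.re, -(b * x.imK), b * x.imJ;
        x.imJ, a * x.imK, x.re, -(a * x.imI);
        x.imK, x.imJ, -x.imI, x.re] := by
    ext r c
    rw [LinearMap.toMatrix_apply, QuaternionAlgebra.coe_basisOneIJK_repr, basisOneIJK_eq]
    fin_cases c <;> fin_cases r <;> simp
  rw [h]
  simp [Matrix.det_succ_row_zero, Fin.sum_univ_succ, Fin.succAbove, nrd]
  ring

theorem det_pairLin (p : ℕ) [Fact p.Prime] (a b : ℚ_[p]) (x : quatPairs p a b) :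
    LinearMap.det (pairLin p a b x.1) = 1 := by
  have h := nrd_mul_nrd_inv p a b x.1.2
  have hx : nrd p a b x.1.1 = nrd p a b x.1.2 := x.2
  rw [pairLin]
  have := LinearMap.det_conj (LinearMap.mulLeft ℚ_[p] (x.1.1 : PQuat p a b) ∘ₗ
      LinearMap.mulRight ℚ_[p] ((x.1.2⁻¹ : (PQuat p a b)ˣ) : PQuat p a b)) (quatCoord p a b)
  rw [this, LinearMap.det_comp, det_mulLeft_quat, det_mulRight_quat, hx, ← mul_pow, h, one_pow]

theorem form_eq_re (p : ℕ) [Fact p.Prime] (a b : ℚ_[p]) (x y : PQuat p a b) :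
    quatCoord p a b x ⬝ᵥ (quatFormMatrix p a b).mulVec (quatCoord p a b y) =
      (x * star y).re := by
  have h := quatKSign_mul_self p
  simp [quatFormMatrix, quatCoord, dotProduct, Fin.sum_univ_four, Matrix.mulVec_diagonal]
  linear_combination (x.imK * a * b * y.imK) * h

theorem re_pair (p : ℕ) [Fact p.Prime] (a b : ℚ_[p]) (x : quatPairs p a b) (η ζ : PQuat p a b) :
    ((x.1.1 * η * ((x.1.2⁻¹ : (PQuat p a b)ˣ) : PQuat p a b)) *
      star (x.1.1 * ζ * ((x.1.2⁻¹ : (PQuat p a b)ˣ) : PQuat p a b))).re = (η * star ζ).re := by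
  have h := nrd_mul_nrd_inv p a b x.1.2
  have hx : nrd p a b x.1.1 = nrd p a b x.1.2 := x.2
  rw [← hx] at h
  generalize ((x.1.2⁻¹ : (PQuat p a b)ˣ) : PQuat p a b) = r at h
  generalize (x.1.1 : PQuat p a b) = s at h
  have key : (s * η * r * star (s * ζ * r)).re =
      nrd p a b s * nrd p a b r * (η * star ζ).re := by
    simp [nrd]; ring
  rw [key, h, one_mul]

theorem pairLin_mem (p : ℕ) [Fact p.Prime] (a b : ℚ_[p]) (x : quatPairs p a b) :
    (LinearMap.toMatrix' (pairLin p a b x.1)).transpose * quatFormMatrix p a b *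
      LinearMap.toMatrix' (pairLin p a b x.1) = quatFormMatrix p a b := by
  have key : ∀ v w : Fin 4 → ℚ_[p],
      v ⬝ᵥ ((LinearMap.toMatrix' (pairLin p a b x.1)).transpose * quatFormMatrix p a b *
        LinearMap.toMatrix' (pairLin p a b x.1)).mulVec w =
      v ⬝ᵥ (quatFormMatrix p a b).mulVec w := by
    intro v w
    obtain ⟨η, rfl⟩ := (quatCoord p a b).surjective v
    obtain ⟨ζ, rfl⟩ := (quatCoord p a b).surjective w
    rw [← Matrix.mulVec_mulVec, ← Matrix.mulVec_mulVec, Matrix.dotProduct_mulVec,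
      Matrix.vecMul_transpose, LinearMap.toMatrix'_mulVec, LinearMap.toMatrix'_mulVec,
      pairLin_apply, pairLin_apply, form_eq_re, form_eq_re, re_pair]
  ext r c
  simpa using key (Pi.single r 1) (Pi.single c 1)

/-- The homomorphism `κ'` that sends `(ξ, ρ)` to the rotation `η ↦ ξ η ρ⁻¹` of `ℍ_p ≅ ℚ_p⁴`. -/
def kappa (p : ℕ) [Fact p.Prime] (a b : ℚ_[p]) : quatPairs p a b →* SO4 p a b where
  toFun x := ⟨⟨LinearMap.toMatrix' (pairLin p a b x.1), by
    rw [LinearMap.det_toMatrix', det_pairLin]⟩, pairLin_mem p a b x⟩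
  map_one' := by
    apply Subtype.ext; apply Subtype.ext
    simp [pairLin_one]
  map_mul' x y := by
    apply Subtype.ext; apply Subtype.ext
    change LinearMap.toMatrix' (pairLin p a b (x.1 * y.1)) =
      LinearMap.toMatrix' (pairLin p a b x.1) * LinearMap.toMatrix' (pairLin p a b y.1)
    rw [pairLin_mul, LinearMap.toMatrix'_comp]

theorem scalarPairs_le_ker (p : ℕ) [Fact p.Prime] (a b : ℚ_[p]) :
    scalarPairs p a b ≤ (kappa p a b).ker := by
  rintro x ⟨α, h1, h2⟩
  rw [MonoidHom.mem_ker]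
  apply Subtype.ext; apply Subtype.ext
  change LinearMap.toMatrix' (pairLin p a b x.1) = 1
  have h : pairLin p a b x.1 = LinearMap.id := by
    refine LinearMap.ext fun q => ?_
    obtain ⟨η, rfl⟩ := (quatCoord p a b).surjective q
    rw [pairLin_apply, h1, QuaternionAlgebra.coe_commutes, ← h2, mul_assoc, Units.mul_inv, mul_one,
      LinearMap.id_apply]
  rw [h, LinearMap.toMatrix'_id]

/-- The homomorphism `P(ℍ_pˣ) / ℚ_pˣ → SO(4, ℚ_p)`, `(ξ, ρ) ℚ_pˣ ↦ (η ↦ ξ η ρ⁻¹)`, by which the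
two groups are identified. -/
def kappaBar (p : ℕ) [Fact p.Prime] (a b : ℚ_[p]) :
    quatPairs p a b ⧸ scalarPairs p a b →* SO4 p a b :=
  QuotientGroup.lift (scalarPairs p a b) (kappa p a b) (scalarPairs_le_ker p a b)

end

/-!
The group `P(ℍ_pˣ)` maps onto `SO(4, ℚ_p)` by `κ (ξ, ρ) = (η ↦ ξ η ρ⁻¹)`, with the central subgroup
of scalars in the kernel. For a weight `ψ` let `m_ψ` be the image under `κ` of the measure with
density `ψ` with respect to the Haar measure of `P(ℍ_pˣ)`. It is finite, since `ψ` has compact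
support, and nonzero. It does not depend on `ψ` (`lintegral_weight_mul_eq`): by Tonelli's theorem,
`∫ ψ₁ F` and `∫ ψ₂ F` are both the integral of `ψ₁(g) F(g) ψ₂(g n)` over pairs `(g, n)`, where the
translation by `n` is harmless because `n` is central. As the translates of a weight are weights and
`κ` is surjective, `m_ψ` is left-invariant, so it is a multiple of the Haar measure of `SO(4, ℚ_p)`,
by a factor that does not depend on `ψ`. This is the formula for the integral
(`exists_integral_eq_integral_weight_mul`); no measure on the quotient group is needed.

Two facts are special to the quaternion algebra, and both rest on the anisotropy of the reduced norm
(`exists_norm_sq_le_nrd`), which comes from Hensel's lemma and a parity argument for odd `p` and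
from the squares modulo `8` for `p = 2`.

* `κ` is surjective (`kappa_surjective`). A rotation is reduced by left multiplication to one that
  fixes `1`, then by conjugations to one that fixes `i` and `j`, which is the identity. The
  conjugating quaternions are explicit and nonzero, hence invertible by anisotropy.
* Weights exist (`wmbWeights_nonempty`). The pairs whose reduced norm has valuation `0` or `1` form
  an open set, which is compact by anisotropy, and which meets every coset of the scalars in a
  translate of the unit scalars. Its normalized indicator function is a weight.
-/

/-! ### Anisotropy of the reduced norm -/

/-- By Hensel's lemma, for odd `p`, a `p`-adic unit that is congruent to a square is a square. -/
theorem Padic.isSquare_of_norm_sq_sub_lt_one {p : ℕ} [Fact p.Prime] (hp : p ≠ 2) {v z : ℚ_[p]}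
    (hv : ‖v‖ = 1) (hz : ‖z‖ = 1) (h : ‖z ^ 2 - v‖ < 1) : IsSquare v := by
  open Polynomial in
  let v' : ℤ_[p] := ⟨v, hv.le⟩
  let z' : ℤ_[p] := ⟨z, hz.le⟩
  have h2 : ‖(2 : ℤ_[p])‖ = 1 := by
    have := (PadicInt.norm_natCast_eq_one_iff (p := p) (n := 2)).2
      ((Nat.coprime_primes Fact.out Nat.prime_two).2 hp)
    exact_mod_cast this
  have hz' : ‖z'‖ = 1 := hz
  have hlt : ‖z' ^ 2 - v'‖ < 1 := h
  obtain ⟨w, hw, -⟩ := hensels_lemma (p := p) (R := ℤ_[p]) (F := X ^ 2 - C v') (a := z') (by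
    simpa [one_add_one_eq_two, h2, hz'] using hlt)
  refine ⟨(w : ℚ_[p]), ?_⟩
  have hw' : w ^ 2 - v' = 0 := by simpa using hw
  have := congrArg (fun t : ℤ_[p] => (t : ℚ_[p])) (sub_eq_zero.1 hw')
  simp only [PadicInt.coe_pow] at this
  rw [← sq, this]

/-- For odd `p`, the norm form `x² - v y²` of the unramified quadratic extension of `ℚ_p` has the
absolute value `max (‖x‖, ‖y‖)²`. -/
theorem Padic.exists_norm_sq_sub_mul_sq_eq {p : ℕ} [Fact p.Prime] (hp : p ≠ 2) {v : ℚ_[p]}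
    (hv : ‖v‖ = 1) (hsq : ¬ IsSquare v) (x y : ℚ_[p]) :
    ∃ s : ℚ_[p], ‖x ^ 2 - v * y ^ 2‖ = ‖s‖ ^ 2 ∧ ‖x‖ ≤ ‖s‖ ∧ ‖y‖ ≤ ‖s‖ := by
  have hvy : ‖-(v * y ^ 2)‖ = ‖y‖ ^ 2 := by rw [norm_neg, norm_mul, hv, one_mul, norm_pow]
  rcases lt_trichotomy ‖x‖ ‖y‖ with h | h | h
  · have h2 : ‖x‖ ^ 2 < ‖y‖ ^ 2 := pow_lt_pow_left₀ h (norm_nonneg _) two_ne_zero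
    refine ⟨y, ?_, h.le, le_rfl⟩
    rw [sub_eq_add_neg, Padic.add_eq_max_of_ne (by rw [hvy, norm_pow]; exact h2.ne), hvy, norm_pow,
      max_eq_right h2.le]
  · refine ⟨y, ?_, h.le, le_rfl⟩
    by_cases hy : y = 0
    · have hx : x = 0 := by simpa [hy] using h
      simp [hx, hy]
    have hy' : ‖y‖ ≠ 0 := norm_ne_zero_iff.2 hy
    have hz : ‖x / y‖ = 1 := by rw [norm_div, h, div_self hy']
    have hge : 1 ≤ ‖(x / y) ^ 2 - v‖ := by
      by_contra hlt
      exact hsq (Padic.isSquare_of_norm_sq_sub_lt_one hp hv hz (not_le.1 hlt))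
    have hle : ‖(x / y) ^ 2 - v‖ ≤ 1 := by
      rw [sub_eq_add_neg]
      refine (Padic.nonarchimedean _ _).trans ?_
      rw [norm_neg, norm_pow, hz, hv]; simp
    have e : x ^ 2 - v * y ^ 2 = y ^ 2 * ((x / y) ^ 2 - v) := by field_simp
    rw [e, norm_mul, le_antisymm hle hge, norm_pow, mul_one]
  · have h2 : ‖y‖ ^ 2 < ‖x‖ ^ 2 := pow_lt_pow_left₀ h (norm_nonneg _) two_ne_zero
    refine ⟨x, ?_, le_rfl, h.le⟩
    rw [sub_eq_add_neg, Padic.add_eq_max_of_ne (by rw [hvy, norm_pow]; exact h2.ne'), hvy,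
      norm_pow, max_eq_left h2.le]

/-- The valuations of `s²` and `p t²` have different parities. -/
theorem Padic.norm_sq_ne_norm_p_mul_sq {p : ℕ} [Fact p.Prime] {s t : ℚ_[p]} (ht : t ≠ 0) :
    ‖s ^ 2‖ ≠ ‖(p : ℚ_[p]) * t ^ 2‖ := by
  intro h
  have hp : (p : ℚ_[p]) ≠ 0 := by exact_mod_cast (Fact.out : p.Prime).ne_zero
  have hpt : (p : ℚ_[p]) * t ^ 2 ≠ 0 := mul_ne_zero hp (pow_ne_zero _ ht)
  have hs : s ≠ 0 := by
    rintro rfl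
    rw [zero_pow two_ne_zero, norm_zero] at h
    exact hpt (norm_eq_zero.1 h.symm)
  rw [Padic.norm_eq_zpow_neg_valuation (pow_ne_zero _ hs),
    Padic.norm_eq_zpow_neg_valuation hpt] at h
  have hp1 : (1 : ℝ) < p := by exact_mod_cast (Fact.out : p.Prime).one_lt
  have h' := zpow_right_injective₀ (zero_lt_one.trans hp1) hp1.ne' h
  rw [Padic.valuation_mul hp (pow_ne_zero _ ht), Padic.valuation_pow, Padic.valuation_pow,
    Padic.valuation_p] at h'
  push_cast at h'
  omega

/-- A sum of four squares one of which is `1` is nonzero modulo `8`. -/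
theorem PadicInt.quarter_le_norm_one_add_squares [Fact (Nat.Prime 2)] (x y z : ℤ_[2]) :
    1 / 4 ≤ ‖1 + x ^ 2 + y ^ 2 + z ^ 2‖ := by
  by_contra hlt
  have h8 : ‖1 + x ^ 2 + y ^ 2 + z ^ 2‖ ≤ ((2 : ℕ) : ℝ) ^ (-((3 : ℕ) : ℤ)) := by
    rw [PadicInt.norm_le_pow_iff_norm_lt_pow_add_one]
    norm_num
    norm_num at hlt
    exact hlt
  rw [PadicInt.norm_le_pow_iff_mem_span_pow, ← PadicInt.ker_toZModPow, RingHom.mem_ker] at h8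
  simp only [map_add, map_one, map_pow] at h8
  have key : ∀ x y z : ZMod (2 ^ 3), 1 + x ^ 2 + y ^ 2 + z ^ 2 ≠ 0 := by decide
  exact key _ _ _ h8

theorem Padic.norm_sq_le_four_mul_norm_sum_squares [Fact (Nat.Prime 2)] {w x y z : ℚ_[2]}
    (hx : ‖x‖ ≤ ‖w‖) (hy : ‖y‖ ≤ ‖w‖) (hz : ‖z‖ ≤ ‖w‖) :
    ‖w‖ ^ 2 ≤ 4 * ‖w ^ 2 + x ^ 2 + y ^ 2 + z ^ 2‖ := by
  by_cases hw : w = 0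
  · simp [hw]
  have hw' : 0 < ‖w‖ := norm_pos_iff.2 hw
  have hdiv : ∀ t : ℚ_[2], ‖t‖ ≤ ‖w‖ → ‖t / w‖ ≤ 1 := fun t ht => by
    rw [norm_div]; exact div_le_one_of_le₀ ht hw'.le
  have h : 1 / 4 ≤ ‖1 + (x / w) ^ 2 + (y / w) ^ 2 + (z / w) ^ 2‖ :=
    PadicInt.quarter_le_norm_one_add_squares ⟨x / w, hdiv x hx⟩ ⟨y / w, hdiv y hy⟩
      ⟨z / w, hdiv z hz⟩
  have e : w ^ 2 + x ^ 2 + y ^ 2 + z ^ 2 =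
      w ^ 2 * (1 + (x / w) ^ 2 + (y / w) ^ 2 + (z / w) ^ 2) := by field_simp
  rw [e, norm_mul, norm_pow]
  nlinarith [pow_pos hw' 2]

section Quat

variable {p : ℕ} [Fact p.Prime] {a b : ℚ_[p]}

theorem nrd_eq (x : PQuat p a b) :
    nrd p a b x = x.re ^ 2 - a * x.imI ^ 2 - b * x.imJ ^ 2 + a * b * x.imK ^ 2 := by
  simp [nrd]; ring

/-- The quantitative form of anisotropy: the reduced norm controls all the coordinates. -/
theorem exists_norm_sq_le_nrd (hab : IsQuatParam p a b) :
    ∃ C : ℝ, ∀ x : PQuat p a b, ‖x.re‖ ^ 2 ≤ C * ‖nrd p a b x‖ ∧ ‖x.imI‖ ^ 2 ≤ C * ‖nrd p a b x‖ ∧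
      ‖x.imJ‖ ^ 2 ≤ C * ‖nrd p a b x‖ ∧ ‖x.imK‖ ^ 2 ≤ C * ‖nrd p a b x‖ := by
  rcases hab with ⟨rfl, rfl, rfl⟩ | ⟨hp, ha, hsq, rfl⟩
  · refine ⟨4, fun x => ?_⟩
    have e : nrd 2 (-1) (-1) x = x.re ^ 2 + x.imI ^ 2 + x.imJ ^ 2 + x.imK ^ 2 := by
      rw [nrd_eq]; ring
    rw [e]
    -- the coordinate `t` of largest norm satisfies the bound, hence so do the others
    have key : ∀ t : ℚ_[2], ‖t‖ ^ 2 ≤ 4 * ‖x.re ^ 2 + x.imI ^ 2 + x.imJ ^ 2 + x.imK ^ 2‖ →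
        ‖x.re‖ ≤ ‖t‖ → ‖x.imI‖ ≤ ‖t‖ → ‖x.imJ‖ ≤ ‖t‖ → ‖x.imK‖ ≤ ‖t‖ →
        ‖x.re‖ ^ 2 ≤ 4 * ‖x.re ^ 2 + x.imI ^ 2 + x.imJ ^ 2 + x.imK ^ 2‖ ∧
        ‖x.imI‖ ^ 2 ≤ 4 * ‖x.re ^ 2 + x.imI ^ 2 + x.imJ ^ 2 + x.imK ^ 2‖ ∧
        ‖x.imJ‖ ^ 2 ≤ 4 * ‖x.re ^ 2 + x.imI ^ 2 + x.imJ ^ 2 + x.imK ^ 2‖ ∧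
        ‖x.imK‖ ^ 2 ≤ 4 * ‖x.re ^ 2 + x.imI ^ 2 + x.imJ ^ 2 + x.imK ^ 2‖ := by
      intro t ht h0 h1 h2 h3
      refine ⟨?_, ?_, ?_, ?_⟩ <;> refine le_trans ?_ ht <;> gcongr
    have hmax : (‖x.imI‖ ≤ ‖x.re‖ ∧ ‖x.imJ‖ ≤ ‖x.re‖ ∧ ‖x.imK‖ ≤ ‖x.re‖) ∨
        (‖x.re‖ ≤ ‖x.imI‖ ∧ ‖x.imJ‖ ≤ ‖x.imI‖ ∧ ‖x.imK‖ ≤ ‖x.imI‖) ∨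
        (‖x.re‖ ≤ ‖x.imJ‖ ∧ ‖x.imI‖ ≤ ‖x.imJ‖ ∧ ‖x.imK‖ ≤ ‖x.imJ‖) ∨
        (‖x.re‖ ≤ ‖x.imK‖ ∧ ‖x.imI‖ ≤ ‖x.imK‖ ∧ ‖x.imJ‖ ≤ ‖x.imK‖) := by grind
    rcases hmax with ⟨h1, h2, h3⟩ | ⟨h1, h2, h3⟩ | ⟨h1, h2, h3⟩ | ⟨h1, h2, h3⟩ <;>
      have h := Padic.norm_sq_le_four_mul_norm_sum_squares h1 h2 h3
    · exact key _ h le_rfl h1 h2 h3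
    · exact key _ (by convert h using 3; ring) h1 le_rfl h2 h3
    · exact key _ (by convert h using 3; ring) h1 h2 le_rfl h3
    · exact key _ (by convert h using 3; ring) h1 h2 h3 le_rfl
  -- the two halves of the form have valuations of different parity, so they cannot cancel
  · refine ⟨p, fun x => ?_⟩
    obtain ⟨s, hs, hs0, hs1⟩ := Padic.exists_norm_sq_sub_mul_sq_eq hp ha hsq x.re x.imI
    obtain ⟨t, ht, ht0, ht1⟩ := Padic.exists_norm_sq_sub_mul_sq_eq hp ha hsq x.imJ x.imK
    have e : nrd p a (-p) x =
        (x.re ^ 2 - a * x.imI ^ 2) + p * (x.imJ ^ 2 - a * x.imK ^ 2) := by rw [nrd_eq]; ring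
    have hp1 : (1 : ℝ) < p := by exact_mod_cast (Fact.out : p.Prime).one_lt
    have hp0 : (0 : ℝ) < p := zero_lt_one.trans hp1
    have hpt : (p : ℝ) * ‖(p : ℚ_[p]) * t ^ 2‖ = ‖t‖ ^ 2 := by
      rw [norm_mul, Padic.norm_p, norm_pow, mul_inv_cancel_left₀ hp0.ne']
    have hn : ‖nrd p a (-p) x‖ = max ‖s ^ 2‖ ‖(p : ℚ_[p]) * t ^ 2‖ := by
      rw [e]
      by_cases ht0 : t = 0
      · have : x.imJ ^ 2 - a * x.imK ^ 2 = 0 := by simpa [ht0] using ht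
        rw [this, ht0]
        simp [hs]
      · have hpt' : ‖(p : ℚ_[p]) * (x.imJ ^ 2 - a * x.imK ^ 2)‖ = ‖(p : ℚ_[p]) * t ^ 2‖ := by
          rw [norm_mul, ht, norm_mul, norm_pow]
        rw [← norm_pow] at hs
        rw [Padic.add_eq_max_of_ne, hs, hpt']
        rw [hs, hpt']
        exact Padic.norm_sq_ne_norm_p_mul_sq ht0
    have hS : ‖s‖ ^ 2 ≤ p * ‖nrd p a (-p) x‖ := by
      rw [hn, ← norm_pow]
      exact (le_mul_of_one_le_left (norm_nonneg _) hp1.le).trans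
        (mul_le_mul_of_nonneg_left (le_max_left _ _) hp0.le)
    have hT : ‖t‖ ^ 2 ≤ p * ‖nrd p a (-p) x‖ := by
      rw [hn, ← hpt]
      exact mul_le_mul_of_nonneg_left (le_max_right _ _) hp0.le
    refine ⟨le_trans ?_ hS, le_trans ?_ hS, le_trans ?_ hT, le_trans ?_ hT⟩ <;> gcongr

theorem nrd_ne_zero (hab : IsQuatParam p a b) {x : PQuat p a b} (hx : x ≠ 0) :
    nrd p a b x ≠ 0 := by
  intro h
  obtain ⟨C, hC⟩ := exists_norm_sq_le_nrd hab
  have := hC x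
  rw [h, norm_zero, mul_zero] at this
  obtain ⟨h0, h1, h2, h3⟩ := this
  have key : ∀ t : ℚ_[p], ‖t‖ ^ 2 ≤ 0 → t = 0 := fun t ht =>
    norm_eq_zero.1 (pow_eq_zero_iff two_ne_zero |>.1 (le_antisymm ht (sq_nonneg _)))
  exact hx (QuaternionAlgebra.ext (key _ h0) (key _ h1) (key _ h2) (key _ h3))

theorem IsQuatParam.left_ne_zero (hab : IsQuatParam p a b) : a ≠ 0 := by
  rcases hab with ⟨_, rfl, _⟩ | ⟨_, ha, _, _⟩
  · simp
  · rintro rfl; simp at ha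

theorem IsQuatParam.right_ne_zero (hab : IsQuatParam p a b) : b ≠ 0 := by
  rcases hab with ⟨_, _, rfl⟩ | ⟨_, _, _, rfl⟩
  · simp
  · simpa using (Fact.out : p.Prime).ne_zero

/-- The unit of the quaternion algebra given by an element of nonzero reduced norm; its inverse is
the conjugate divided by the reduced norm. -/
noncomputable def unitOfNrd (x : PQuat p a b) (hx : nrd p a b x ≠ 0) : (PQuat p a b)ˣ where
  val := x
  inv := (nrd p a b x)⁻¹ • star x
  val_inv := by
    rw [mul_smul_comm, ← coe_nrd, QuaternionAlgebra.smul_coe, inv_mul_cancel₀ hx,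
      QuaternionAlgebra.coe_one]
  inv_val := by
    have : star x * x = ((nrd p a b x : ℚ_[p]) : PQuat p a b) := by
      ext <;> simp [nrd] <;> ring
    rw [smul_mul_assoc, this, QuaternionAlgebra.smul_coe, inv_mul_cancel₀ hx,
      QuaternionAlgebra.coe_one]

theorem nrd_unit_ne_zero (x : (PQuat p a b)ˣ) : nrd p a b x ≠ 0 :=
  left_ne_zero_of_mul_eq_one (nrd_mul_nrd_inv p a b x)

/-! ### Surjectivity of the double covering of the special orthogonal group -/

/-- The action of a rotation on quaternions, through their coordinates in the basis `1, i, j, k`. -/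
noncomputable def rot (L : SO4 p a b) (x : PQuat p a b) : PQuat p a b :=
  (quatCoord p a b).symm (L.1.1.mulVec (quatCoord p a b x))

theorem rot_mul (L M : SO4 p a b) (x : PQuat p a b) : rot (L * M) x = rot L (rot M x) := by
  simp [rot]

theorem rot_one (x : PQuat p a b) : rot 1 x = x := by
  simp [rot]

theorem rot_kappa (g : quatPairs p a b) (x : PQuat p a b) :
    rot (kappa p a b g) x = g.1.1 * x * ((g.1.2⁻¹ : (PQuat p a b)ˣ) : PQuat p a b) := by
  rw [rot, LinearEquiv.symm_apply_eq, ← pairLin_apply]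
  exact LinearMap.toMatrix'_mulVec _ _

theorem re_rot_mul_star_rot (L : SO4 p a b) (x y : PQuat p a b) :
    (rot L x * star (rot L y)).re = (x * star y).re := by
  have hL : L.1.1.transpose * quatFormMatrix p a b * L.1.1 = quatFormMatrix p a b := L.2
  rw [← form_eq_re, ← form_eq_re]
  simp only [rot, LinearEquiv.apply_symm_apply]
  conv_rhs => rw [← hL]
  rw [← Matrix.mulVec_mulVec, ← Matrix.mulVec_mulVec, Matrix.dotProduct_mulVec _ L.1.1.transpose,
    Matrix.vecMul_transpose]

theorem nrd_rot (L : SO4 p a b) (x : PQuat p a b) : nrd p a b (rot L x) = nrd p a b x :=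
  re_rot_mul_star_rot L x x

/-- A rotation that fixes `1`, `i` and `j` is the identity: the image of `k` is a multiple of `k`
by orthogonality, and the determinant fixes the factor. -/
theorem eq_one_of_rot_eq_self (hab : IsQuatParam p a b) {L : SO4 p a b} (h0 : rot L 1 = 1)
    (h1 : rot L ⟨0, 1, 0, 0⟩ = ⟨0, 1, 0, 0⟩) (h2 : rot L ⟨0, 0, 1, 0⟩ = ⟨0, 0, 1, 0⟩) : L = 1 := by
  have ha := hab.left_ne_zero
  have hb := hab.right_ne_zero
  have c0 : ∀ i, L.1.1 i 0 = (![1, 0, 0, 0] : Fin 4 → ℚ_[p]) i := fun i => by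
    have := congrFun ((LinearEquiv.symm_apply_eq _).1 h0) i
    fin_cases i <;> simpa [quatCoord, Matrix.mulVec, dotProduct, Fin.sum_univ_four] using this
  have c1 : ∀ i, L.1.1 i 1 = (![0, 1, 0, 0] : Fin 4 → ℚ_[p]) i := fun i => by
    have := congrFun ((LinearEquiv.symm_apply_eq _).1 h1) i
    fin_cases i <;> simpa [quatCoord, Matrix.mulVec, dotProduct, Fin.sum_univ_four] using this
  have c2 : ∀ i, L.1.1 i 2 = (![0, 0, 1, 0] : Fin 4 → ℚ_[p]) i := fun i => by
    have := congrFun ((LinearEquiv.symm_apply_eq _).1 h2) i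
    fin_cases i <;> simpa [quatCoord, Matrix.mulVec, dotProduct, Fin.sum_univ_four] using this
  have hL : L.1.1.transpose * quatFormMatrix p a b * L.1.1 = quatFormMatrix p a b := L.2
  have e : ∀ r, (L.1.1.transpose * quatFormMatrix p a b * L.1.1) r 3 = quatFormMatrix p a b r 3 :=
    fun r => by rw [hL]
  have e0 : L.1.1 0 3 = 0 := by
    simpa [quatFormMatrix, Matrix.mul_apply, Fin.sum_univ_four, Matrix.diagonal, c0] using e 0
  have e1 : L.1.1 1 3 = 0 := by
    simpa [quatFormMatrix, Matrix.mul_apply, Fin.sum_univ_four, Matrix.diagonal, c1, ha] using e 1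
  have e2 : L.1.1 2 3 = 0 := by
    simpa [quatFormMatrix, Matrix.mul_apply, Fin.sum_univ_four, Matrix.diagonal, c2, hb] using e 2
  have e3 : L.1.1 3 3 = 1 := by
    have hdet : L.1.1.det = 1 := L.1.2
    have hd : L.1.1 = Matrix.diagonal ![1, 1, 1, L.1.1 3 3] := by
      ext i j
      fin_cases i <;> fin_cases j <;> simp [c0, c1, c2, e0, e1, e2, Matrix.diagonal]
    rw [hd, Matrix.det_diagonal] at hdet
    simpa [Fin.prod_univ_four] using hdet
  apply Subtype.ext; apply Subtype.ext
  ext i j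
  fin_cases i <;> fin_cases j <;> simp [c0, c1, c2, e0, e1, e2, e3]

/-- Conjugation by a nonzero quaternion, as an element of the group of pairs. -/
noncomputable def conjPair (w : PQuat p a b) (hw : nrd p a b w ≠ 0) : quatPairs p a b :=
  ⟨(unitOfNrd w hw, unitOfNrd w hw), rfl⟩

theorem rot_kappa_conjPair {w : PQuat p a b} (hw : nrd p a b w ≠ 0) {x y : PQuat p a b}
    (h : w * x = y * w) : rot (kappa p a b (conjPair w hw)) x = y := by
  rw [rot_kappa]
  change w * x * _ = y
  rw [h]
  exact Units.mul_inv_cancel_right y (unitOfNrd w hw)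

theorem rot_inv_mul {L M : SO4 p a b} {x y : PQuat p a b} (hL : rot L x = y) (hM : rot M x = y) :
    rot (M⁻¹ * L) x = x := by
  rw [rot_mul, hL, ← hM, ← rot_mul, inv_mul_cancel, rot_one]

/-- Every rotation that fixes `1`, `i` is a conjugation, by an element of the plane of `1`, `i`. -/
theorem mem_range_kappa_of_rot_i (hab : IsQuatParam p a b) {L : SO4 p a b} (h0 : rot L 1 = 1)
    (h1 : rot L ⟨0, 1, 0, 0⟩ = ⟨0, 1, 0, 0⟩) : L ∈ (kappa p a b).range := by
  have ha := hab.left_ne_zero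
  -- it suffices to find a nonzero `w` that commutes with `i` and conjugates `j` to its image
  suffices h : ∃ w : PQuat p a b, w ≠ 0 ∧ w * ⟨0, 1, 0, 0⟩ = ⟨0, 1, 0, 0⟩ * w ∧
      w * ⟨0, 0, 1, 0⟩ = rot L ⟨0, 0, 1, 0⟩ * w by
    obtain ⟨w, hw, hi, hj⟩ := h
    have hw' := nrd_ne_zero hab hw
    have := eq_one_of_rot_eq_self hab (L := (kappa p a b (conjPair w hw'))⁻¹ * L)
      (rot_inv_mul h0 (rot_kappa_conjPair hw' (by simp)))
      (rot_inv_mul h1 (rot_kappa_conjPair hw' hi)) (rot_inv_mul rfl (rot_kappa_conjPair hw' hj))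
    exact ⟨conjPair w hw', inv_mul_eq_one.1 this⟩
  have r0 := re_rot_mul_star_rot L ⟨0, 0, 1, 0⟩ 1
  have r1 := re_rot_mul_star_rot L ⟨0, 0, 1, 0⟩ ⟨0, 1, 0, 0⟩
  have rn := nrd_rot L ⟨0, 0, 1, 0⟩
  rw [h0] at r0
  rw [h1] at r1
  generalize rot L ⟨0, 0, 1, 0⟩ = y at r0 r1 rn
  obtain ⟨y0, y1, y2, y3⟩ := y
  simp at r0
  simp [r0, ha] at r1
  subst r0 r1
  simp [nrd_eq] at rn
  by_cases hy : (⟨0, 0, y2, y3⟩ : PQuat p a b) = ⟨0, 0, -1, 0⟩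
  · rw [hy]
    exact ⟨⟨0, 1, 0, 0⟩, by simp [QuaternionAlgebra.ext_iff], rfl, by ext <;> simp⟩
  -- `w = b + y j` satisfies `y w = y b + b j = w j`, because `y² = b = j²`
  · refine ⟨⟨b, 0, 0, 0⟩ + ⟨0, 0, y2, y3⟩ * ⟨0, 0, 1, 0⟩, ?_, ?_, ?_⟩
    · intro h
      apply hy
      simp [QuaternionAlgebra.ext_iff] at h ⊢
      have hb := hab.right_ne_zero
      constructor
      · apply mul_left_cancel₀ hb; linear_combination h.1
      · tauto
    · ext <;> simp
    · ext <;> simp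
      · linear_combination rn
      · ring

/-- Every rotation that fixes `1` is a conjugation. -/
theorem mem_range_kappa_of_rot_one (hab : IsQuatParam p a b) {L : SO4 p a b} (h0 : rot L 1 = 1) :
    L ∈ (kappa p a b).range := by
  suffices h : ∃ w : PQuat p a b, w ≠ 0 ∧ w * ⟨0, 1, 0, 0⟩ = rot L ⟨0, 1, 0, 0⟩ * w by
    obtain ⟨w, hw, hi⟩ := h
    have hw' := nrd_ne_zero hab hw
    have := mem_range_kappa_of_rot_i hab (L := (kappa p a b (conjPair w hw'))⁻¹ * L)
      (rot_inv_mul h0 (rot_kappa_conjPair hw' (by simp)))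
      (rot_inv_mul rfl (rot_kappa_conjPair hw' hi))
    exact (Subgroup.mul_mem_cancel_left _ (inv_mem (MonoidHom.mem_range.2 ⟨conjPair w hw', rfl⟩))).1
      this
  have r0 := re_rot_mul_star_rot L ⟨0, 1, 0, 0⟩ 1
  have rn := nrd_rot L ⟨0, 1, 0, 0⟩
  rw [h0] at r0
  generalize rot L ⟨0, 1, 0, 0⟩ = y at r0 rn
  obtain ⟨y0, y1, y2, y3⟩ := y
  simp at r0
  subst r0
  simp [nrd_eq] at rn
  by_cases hy : (⟨0, y1, y2, y3⟩ : PQuat p a b) = ⟨0, -1, 0, 0⟩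
  · rw [hy]
    exact ⟨⟨0, 0, 1, 0⟩, by simp [QuaternionAlgebra.ext_iff], by ext <;> simp⟩
  · refine ⟨⟨0, 1, 0, 0⟩ + ⟨0, y1, y2, y3⟩, ?_, ?_⟩
    · intro h
      apply hy
      rw [add_eq_zero_iff_neg_eq] at h
      rw [← h]; ext <;> simp
    -- with `w = i + y` both products are `a + y i`, because `y² = -nrd y = a`
    · ext <;> simp
      · linear_combination rn
      all_goals ring

/-- The homomorphism `κ` is onto: left multiplication by the image of `1`, which has reduced norm
`1`, reduces a rotation to one that fixes `1`. -/
theorem kappa_surjective (hab : IsQuatParam p a b) : Function.Surjective (kappa p a b) := by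
  rw [← MonoidHom.range_eq_top, eq_top_iff]
  intro L _
  have hn : nrd p a b (rot L 1) = 1 := by rw [nrd_rot, nrd_one]
  let g : quatPairs p a b :=
    ⟨(unitOfNrd (rot L 1) (by rw [hn]; exact one_ne_zero), 1), hn.trans (nrd_one p a b).symm⟩
  have := mem_range_kappa_of_rot_one hab (L := (kappa p a b g)⁻¹ * L)
    (rot_inv_mul rfl (by simp [rot_kappa, g, unitOfNrd]))
  exact (Subgroup.mul_mem_cancel_left _ (inv_mem (MonoidHom.mem_range.2 ⟨g, rfl⟩))).1 this

end Quat

/-! ### Topology of the quaternion algebra and of the groups -/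

section Topology

variable {p : ℕ} [Fact p.Prime] {a b : ℚ_[p]}

/-- The coordinates of a quaternion with respect to `1, i, j, ij`, as a homeomorphism. -/
noncomputable def PQuat.homeomorphTuple (p : ℕ) [Fact p.Prime] (a b : ℚ_[p]) :
    PQuat p a b ≃ₜ (Fin 4 → ℚ_[p]) :=
  (QuaternionAlgebra.equivTuple a 0 b).toHomeomorphOfIsInducing ⟨rfl⟩

theorem PQuat.homeomorphTuple_apply (x : PQuat p a b) :
    PQuat.homeomorphTuple p a b x = ![x.re, x.imI, x.imJ, x.imK] := rfl

@[fun_prop]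
theorem PQuat.continuous_re : Continuous fun x : PQuat p a b => x.re :=
  (continuous_apply 0).comp (PQuat.homeomorphTuple p a b).continuous

@[fun_prop]
theorem PQuat.continuous_imI : Continuous fun x : PQuat p a b => x.imI :=
  (continuous_apply 1).comp (PQuat.homeomorphTuple p a b).continuous

@[fun_prop]
theorem PQuat.continuous_imJ : Continuous fun x : PQuat p a b => x.imJ :=
  (continuous_apply 2).comp (PQuat.homeomorphTuple p a b).continuous

@[fun_prop]
theorem PQuat.continuous_imK : Continuous fun x : PQuat p a b => x.imK :=
  (continuous_apply 3).comp (PQuat.homeomorphTuple p a b).continuous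

theorem PQuat.continuous_of_coord {X : Type*} [TopologicalSpace X] {f : X → PQuat p a b}
    (h0 : Continuous fun x => (f x).re) (h1 : Continuous fun x => (f x).imI)
    (h2 : Continuous fun x => (f x).imJ) (h3 : Continuous fun x => (f x).imK) : Continuous f := by
  rw [← (PQuat.homeomorphTuple p a b).comp_continuous_iff]
  refine continuous_pi fun i => ?_
  fin_cases i
  exacts [h0, h1, h2, h3]

instance PQuat.instT2Space : T2Space (PQuat p a b) :=
  (PQuat.homeomorphTuple p a b).isEmbedding.t2Space

instance PQuat.instSecondCountableTopology : SecondCountableTopology (PQuat p a b) :=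
  (PQuat.homeomorphTuple p a b).isEmbedding.secondCountableTopology

instance PQuat.instContinuousMul : ContinuousMul (PQuat p a b) where
  continuous_mul := by
    apply PQuat.continuous_of_coord <;> simp <;> fun_prop

@[fun_prop]
theorem continuous_nrd : Continuous (nrd p a b) := by
  simp only [funext nrd_eq]
  fun_prop

theorem continuous_quatCoord : Continuous (quatCoord p a b) := by
  refine continuous_pi fun i => ?_
  fin_cases i <;> simp [quatCoord] <;> fun_prop

instance Units.instSecondCountableTopology {M : Type*} [Monoid M] [TopologicalSpace M]
    [SecondCountableTopology M] : SecondCountableTopology Mˣ :=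
  have : SecondCountableTopology Mᵐᵒᵖ :=
    MulOpposite.opHomeomorph.symm.isEmbedding.secondCountableTopology
  Units.isEmbedding_embedProduct.secondCountableTopology

instance quatPairs.instSecondCountableTopology : SecondCountableTopology (quatPairs p a b) :=
  Topology.IsEmbedding.subtypeVal.secondCountableTopology

theorem isClosed_quatPairs :
    IsClosed (quatPairs p a b : Set ((PQuat p a b)ˣ × (PQuat p a b)ˣ)) :=
  isClosed_eq (continuous_nrd.comp (Units.continuous_val.comp continuous_fst))
    (continuous_nrd.comp (Units.continuous_val.comp continuous_snd))

theorem isClosed_scalarPairs : IsClosed (scalarPairs p a b : Set (quatPairs p a b)) := by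
  have e : (scalarPairs p a b : Set (quatPairs p a b)) =
      {x | (x.1.1 : PQuat p a b) = ((x.1.1 : PQuat p a b).re : PQuat p a b) ∧
        (x.1.2 : PQuat p a b) = ((x.1.1 : PQuat p a b).re : PQuat p a b)} := by
    ext x
    constructor
    · rintro ⟨α, h1, h2⟩
      simp [h1, h2]
    · rintro ⟨h1, h2⟩
      refine ⟨Units.mk0 (x.1.1 : PQuat p a b).re fun h => ?_, h1, h2⟩
      rw [h, QuaternionAlgebra.coe_zero] at h1
      exact x.1.1.ne_zero h1
  have h1 : Continuous fun x : quatPairs p a b => (x.1.1 : PQuat p a b) :=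
    Units.continuous_val.comp (continuous_fst.comp continuous_subtype_val)
  have h2 : Continuous fun x : quatPairs p a b => (x.1.2 : PQuat p a b) :=
    Units.continuous_val.comp (continuous_snd.comp continuous_subtype_val)
  have h3 : Continuous fun x : quatPairs p a b =>
      ((x.1.1 : PQuat p a b).re : PQuat p a b) := by
    apply PQuat.continuous_of_coord <;> simp <;> fun_prop
  rw [e]
  exact (isClosed_eq h1 h3).inter (isClosed_eq h2 h3)

theorem continuous_kappa : Continuous (kappa p a b) := by
  refine Continuous.subtype_mk (Continuous.subtype_mk (continuous_matrix fun i j => ?_) _) _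
  have h1 : Continuous fun x : quatPairs p a b => (x.1.1 : PQuat p a b) :=
    Units.continuous_val.comp (continuous_fst.comp continuous_subtype_val)
  have h2 : Continuous fun x : quatPairs p a b => ((x.1.2⁻¹ : (PQuat p a b)ˣ) : PQuat p a b) :=
    Units.continuous_val.comp (continuous_inv.comp (continuous_snd.comp continuous_subtype_val))
  simp only [LinearMap.toMatrix'_apply, pairLin, LinearMap.comp_apply, LinearEquiv.coe_coe,
    LinearMap.mulLeft_apply, LinearMap.mulRight_apply]
  exact (continuous_apply i).comp (continuous_quatCoord.comp
    (h1.mul (continuous_const.mul h2)))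

theorem isClosedEmbedding_SO4_val :
    Topology.IsClosedEmbedding fun L : SO4 p a b => (L.1.1 : Matrix (Fin 4) (Fin 4) ℚ_[p]) := by
  refine Matrix.SpecialLinearGroup.isClosedEmbedding_val.comp
    (IsClosed.isClosedEmbedding_subtypeVal ?_)
  have : Continuous fun L : Matrix.SpecialLinearGroup (Fin 4) ℚ_[p] => L.1 :=
    continuous_subtype_val
  exact isClosed_eq ((this.matrix_transpose.matrix_mul continuous_const).matrix_mul this)
    continuous_const

instance SO4.instLocallyCompactSpace : LocallyCompactSpace (SO4 p a b) :=
  have : LocallyCompactSpace (Matrix (Fin 4) (Fin 4) ℚ_[p]) :=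
    inferInstanceAs (LocallyCompactSpace (Fin 4 → Fin 4 → ℚ_[p]))
  isClosedEmbedding_SO4_val.locallyCompactSpace

instance SO4.instSecondCountableTopology : SecondCountableTopology (SO4 p a b) :=
  have : SecondCountableTopology (Matrix (Fin 4) (Fin 4) ℚ_[p]) :=
    inferInstanceAs (SecondCountableTopology (Fin 4 → Fin 4 → ℚ_[p]))
  isClosedEmbedding_SO4_val.isEmbedding.secondCountableTopology

/-! ### A compact open set of representatives modulo the scalars -/

/-- The pairs whose reduced norm has valuation `0` or `1`. Up to units of `ℤ_p`, every pair is
brought into this set by exactly one scalar. -/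
def nrdShell (p : ℕ) [Fact p.Prime] (a b : ℚ_[p]) : Set (quatPairs p a b) :=
  {g | (nrd p a b g.1.1).valuation = 0 ∨ (nrd p a b g.1.1).valuation = 1}

theorem Padic.valuation_eq_iff_norm {x : ℚ_[p]} (hx : x ≠ 0) (n : ℤ) :
    x.valuation = n ↔ ‖x‖ = (p : ℝ) ^ (-n) := by
  have hp1 : (1 : ℝ) < p := by exact_mod_cast (Fact.out : p.Prime).one_lt
  rw [Padic.norm_eq_zpow_neg_valuation hx,
    (zpow_right_injective₀ (zero_lt_one.trans hp1) hp1.ne').eq_iff, neg_inj]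

theorem mem_nrdShell_iff (g : quatPairs p a b) : g ∈ nrdShell p a b ↔
    nrd p a b g.1.1 ∈ Metric.sphere (0 : ℚ_[p]) 1 ∪ Metric.sphere (0 : ℚ_[p]) (p : ℝ)⁻¹ := by
  have h := nrd_unit_ne_zero g.1.1
  simp [nrdShell, Padic.valuation_eq_iff_norm h]

theorem isClopen_nrdShell : IsClopen (nrdShell p a b) := by
  have e : nrdShell p a b = (fun g : quatPairs p a b => nrd p a b g.1.1) ⁻¹'
      (Metric.sphere (0 : ℚ_[p]) 1 ∪ Metric.sphere (0 : ℚ_[p]) (p : ℝ)⁻¹) :=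
    Set.ext mem_nrdShell_iff
  rw [e]
  have hp : (p : ℝ)⁻¹ ≠ 0 := by
    have := (Fact.out : p.Prime).ne_zero
    positivity
  refine IsClopen.preimage ⟨Metric.isClosed_sphere.union Metric.isClosed_sphere,
    (IsUltrametricDist.isOpen_sphere _ one_ne_zero).union (IsUltrametricDist.isOpen_sphere _ hp)⟩ ?_
  exact continuous_nrd.comp
    (Units.continuous_val.comp (continuous_fst.comp continuous_subtype_val))

theorem isCompact_nrd_preimage (hab : IsQuatParam p a b) {s : Set ℚ_[p]} (hs : IsCompact s) :
    IsCompact (nrd p a b ⁻¹' s) := by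
  obtain ⟨C, hC⟩ := exists_norm_sq_le_nrd hab
  obtain ⟨R, hR⟩ := hs.isBounded.exists_norm_le
  have hb := (PQuat.homeomorphTuple p a b).isCompact_preimage.2
    (isCompact_closedBall (0 : Fin 4 → ℚ_[p]) (√(|C| * R)))
  refine hb.of_isClosed_subset (hs.isClosed.preimage continuous_nrd) fun x hx => ?_
  have hxR : C * ‖nrd p a b x‖ ≤ |C| * R :=
    (mul_le_mul_of_nonneg_right (le_abs_self C) (norm_nonneg _)).trans
      (mul_le_mul_of_nonneg_left (hR _ hx) (abs_nonneg C))
  obtain ⟨h0, h1, h2, h3⟩ := hC x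
  rw [Set.mem_preimage, mem_closedBall_zero_iff, pi_norm_le_iff_of_nonneg (Real.sqrt_nonneg _),
    PQuat.homeomorphTuple_apply]
  intro i
  fin_cases i
  exacts [Real.le_sqrt_of_sq_le (h0.trans hxR), Real.le_sqrt_of_sq_le (h1.trans hxR),
    Real.le_sqrt_of_sq_le (h2.trans hxR), Real.le_sqrt_of_sq_le (h3.trans hxR)]

theorem isCompact_units_nrd_preimage (hab : IsQuatParam p a b) {s : Set ℚ_[p]} (hs : IsCompact s)
    (h0 : (0 : ℚ_[p]) ∉ s) : IsCompact {x : (PQuat p a b)ˣ | nrd p a b x ∈ s} := by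
  have hc := isCompact_iff_compactSpace.1 (isCompact_nrd_preimage hab hs)
  have hne : ∀ x : nrd p a b ⁻¹' s, nrd p a b x ≠ 0 := fun x h => h0 (h ▸ x.2)
  let f : nrd p a b ⁻¹' s → (PQuat p a b)ˣ := fun x => unitOfNrd x.1 (hne x)
  have hstar : Continuous fun x : nrd p a b ⁻¹' s => (nrd p a b x.1)⁻¹ • star x.1 := by
    have hi : Continuous fun x : nrd p a b ⁻¹' s => (nrd p a b x.1)⁻¹ :=
      (continuous_nrd.comp continuous_subtype_val).inv₀ hne
    apply PQuat.continuous_of_coord <;> simp <;> fun_prop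
  have hf : Continuous f := Units.continuous_iff.2 ⟨continuous_subtype_val, hstar⟩
  convert isCompact_range hf
  ext x
  constructor
  · intro hx
    exact ⟨⟨x, hx⟩, Units.ext rfl⟩
  · rintro ⟨y, rfl⟩
    exact y.2

theorem isCompact_nrdShell (hab : IsQuatParam p a b) : IsCompact (nrdShell p a b) := by
  have hp : (p : ℝ)⁻¹ ≠ 0 := by
    have := (Fact.out : p.Prime).ne_zero
    positivity
  have hu := isCompact_units_nrd_preimage hab
    (s := Metric.sphere (0 : ℚ_[p]) 1 ∪ Metric.sphere (0 : ℚ_[p]) (p : ℝ)⁻¹)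
    ((isCompact_sphere _ _).union (isCompact_sphere _ _)) (by
      rw [Set.mem_union, mem_sphere_zero_iff_norm, mem_sphere_zero_iff_norm, norm_zero]
      exact fun h => h.elim zero_ne_one (fun h => hp h.symm))
  have hK := isClosed_quatPairs.isClosedEmbedding_subtypeVal.isCompact_preimage (hu.prod hu)
  convert hK using 1
  ext g
  have hg : nrd p a b g.1.1 = nrd p a b g.1.2 := g.2
  rw [mem_nrdShell_iff, Set.mem_preimage, Set.mem_prod, Set.mem_ofPred_eq, Set.mem_ofPred_eq, ← hg,
    and_self]

theorem one_mem_nrdShell : 1 ∈ nrdShell p a b := by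
  left
  change (nrd p a b 1).valuation = 0
  rw [nrd_one, Padic.valuation_one]

theorem locallyCompactSpace_quatPairs (hab : IsQuatParam p a b) :
    LocallyCompactSpace (quatPairs p a b) :=
  (isCompact_nrdShell hab).locallyCompactSpace_of_mem_nhds_of_group
    (isClopen_nrdShell.isOpen.mem_nhds one_mem_nrdShell)

theorem mul_comm_of_mem_scalarPairs {n : quatPairs p a b} (hn : n ∈ scalarPairs p a b)
    (g : quatPairs p a b) : n * g = g * n := by
  obtain ⟨α, h1, h2⟩ := hn
  refine Subtype.ext (Prod.ext (Units.ext ?_) (Units.ext ?_))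
  · change (n.1.1 : PQuat p a b) * g.1.1 = g.1.1 * n.1.1
    rw [h1, QuaternionAlgebra.coe_commutes]
  · change (n.1.2 : PQuat p a b) * g.1.2 = g.1.2 * n.1.2
    rw [h2, QuaternionAlgebra.coe_commutes]

theorem valuation_nrd_mul (g h : quatPairs p a b) :
    (nrd p a b (g * h).1.1).valuation =
      (nrd p a b g.1.1).valuation + (nrd p a b h.1.1).valuation := by
  change (nrd p a b (g.1.1 * h.1.1)).valuation = _
  rw [nrd_mul, Padic.valuation_mul (nrd_unit_ne_zero _) (nrd_unit_ne_zero _)]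

theorem even_valuation_nrd_of_mem_scalarPairs {n : quatPairs p a b} (hn : n ∈ scalarPairs p a b) :
    Even (nrd p a b n.1.1).valuation := by
  obtain ⟨α, h1, -⟩ := hn
  refine ⟨(α : ℚ_[p]).valuation, ?_⟩
  rw [h1, nrd_eq]
  simp [Padic.valuation_pow, two_mul]

/-- A scalar keeps an element of the shell inside it exactly if it lies in the shell itself. -/
theorem mul_mem_nrdShell_iff {g n : quatPairs p a b} (hg : g ∈ nrdShell p a b)
    (hn : n ∈ scalarPairs p a b) : g * n ∈ nrdShell p a b ↔ n ∈ nrdShell p a b := by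
  obtain ⟨k, hk⟩ := even_valuation_nrd_of_mem_scalarPairs hn
  simp only [nrdShell, Set.mem_ofPred_eq, valuation_nrd_mul, hk] at hg ⊢
  omega

/-- The diagonal pair `(p ^ k, p ^ k)` has a reduced norm of valuation `2 k`. -/
theorem exists_mem_scalarPairs_valuation_nrd (k : ℤ) :
    ∃ n ∈ scalarPairs p a b, (nrd p a b n.1.1).valuation = 2 * k := by
  have hp : (p : ℚ_[p]) ≠ 0 := by exact_mod_cast (Fact.out : p.Prime).ne_zero
  let α : ℚ_[p]ˣ := Units.mk0 ((p : ℚ_[p]) ^ k) (zpow_ne_zero _ hp)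
  let u : (PQuat p a b)ˣ := Units.map (algebraMap ℚ_[p] (PQuat p a b)).toMonoidHom α
  have hu : (u : PQuat p a b) = ((α : ℚ_[p]) : PQuat p a b) := rfl
  refine ⟨⟨(u, u), rfl⟩, ⟨α, hu, hu⟩, ?_⟩
  change (nrd p a b u).valuation = _
  rw [hu, nrd_eq]
  simp [α, Padic.valuation_pow, Padic.valuation_zpow]

theorem exists_mul_mem_nrdShell (g : quatPairs p a b) :
    ∃ n ∈ scalarPairs p a b, g * n ∈ nrdShell p a b := by
  -- floor division leaves the remainder `0` or `1` as the new valuation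
  obtain ⟨n, hn, hk⟩ := exists_mem_scalarPairs_valuation_nrd (a := a) (b := b)
    (-((nrd p a b g.1.1).valuation / 2))
  refine ⟨n, hn, ?_⟩
  simp only [nrdShell, Set.mem_ofPred_eq, valuation_nrd_mul, hk]
  omega

/-- Normalized indicator functions of the shell are weights. -/
theorem wmbWeights_nonempty (hab : IsQuatParam p a b) (ν : Measure (scalarPairs p a b))
    [ν.IsHaarMeasure] : (wmbWeights ν).Nonempty := by
  let U : Set (scalarPairs p a b) := Subtype.val ⁻¹' nrdShell p a b
  have hUc : IsCompact U :=
    isClosed_scalarPairs.isClosedEmbedding_subtypeVal.isCompact_preimage (isCompact_nrdShell hab)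
  have hUo : IsOpen U := isClopen_nrdShell.isOpen.preimage continuous_subtype_val
  have hU0 : ν.real U ≠ 0 :=
    ENNReal.toReal_ne_zero.2 ⟨hUo.measure_ne_zero ν ⟨1, one_mem_nrdShell⟩, hUc.measure_lt_top.ne⟩
  let c : ℝ := (ν.real U)⁻¹
  refine ⟨(nrdShell p a b).indicator fun _ => c,
    isClopen_nrdShell.continuous_indicator continuous_const, ?_,
    fun g => Set.indicator_nonneg (fun _ _ => inv_nonneg.2 measureReal_nonneg) g, ?_, ?_⟩
  · exact HasCompactSupport.intro (isCompact_nrdShell hab) fun x hx =>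
      Set.indicator_of_notMem hx _
  · intro h
    have := congrFun h 1
    rw [Set.indicator_of_mem one_mem_nrdShell] at this
    exact inv_ne_zero hU0 this
  · intro x
    obtain ⟨g, rfl⟩ := QuotientGroup.mk_surjective x
    obtain ⟨n, hn, hg⟩ := exists_mul_mem_nrdShell g
    rw [← QuotientGroup.mk_mul_of_mem g hn, weilMap_mk]
    have e : (fun h : scalarPairs p a b =>
        (nrdShell p a b).indicator (fun _ => c) (g * n * (h : quatPairs p a b))) =
        U.indicator fun _ => c := by
      funext h
      by_cases hh : (h : quatPairs p a b) ∈ nrdShell p a b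
      · rw [Set.indicator_of_mem ((mul_mem_nrdShell_iff hg h.2).2 hh),
          Set.indicator_of_mem (show h ∈ U from hh)]
      · rw [Set.indicator_of_notMem (mt (mul_mem_nrdShell_iff hg h.2).1 hh),
          Set.indicator_of_notMem (show h ∉ U from hh)]
    rw [e, integral_indicator hUo.measurableSet, setIntegral_const, smul_eq_mul]
    exact mul_inv_cancel₀ hU0

end Topology

/-! ### Weil's formula for a central subgroup -/

section Weil

open scoped ENNReal

variable {G : Type*} [Group G] [MeasurableSpace G] [MeasurableMul₂ G] [MeasurableInv G]

/-- Two weight functions with the same integral `1` over every coset of a central subgroup `N` give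
the same integrals of `N`-invariant functions. By Tonelli's theorem both are equal to the integral
of `ψ₁(g) F(g) ψ₂(g n)` over `G × N`, as translation by `n` preserves `μ`. -/
theorem lintegral_weight_mul_eq {N : Subgroup G} (hN : ∀ n ∈ N, ∀ g : G, n * g = g * n)
    (ν : Measure N) [SFinite ν] [ν.IsInvInvariant] (μ : Measure G) [SFinite μ]
    [μ.IsMulLeftInvariant] {ψ₁ ψ₂ F : G → ℝ≥0∞} (hψ₁ : Measurable ψ₁) (hψ₂ : Measurable ψ₂)
    (hF : Measurable F) (h₁ : ∀ g, ∫⁻ n : N, ψ₁ (g * n) ∂ν = 1)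
    (h₂ : ∀ g, ∫⁻ n : N, ψ₂ (g * n) ∂ν = 1) (hFN : ∀ g, ∀ n ∈ N, F (n * g) = F g) :
    ∫⁻ g, ψ₁ g * F g ∂μ = ∫⁻ g, ψ₂ g * F g ∂μ := by
  have hsub : Measurable fun n : N => (n : G) := measurable_subtype_coe
  have : MeasurableInv N := ⟨(measurable_inv.comp hsub).subtype_mk⟩
  calc ∫⁻ g, ψ₁ g * F g ∂μ = ∫⁻ g, ∫⁻ n : N, ψ₁ g * F g * ψ₂ (g * n) ∂ν ∂μ := by
        refine lintegral_congr fun g => ?_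
        rw [lintegral_const_mul _ (by fun_prop), h₂, mul_one]
    _ = ∫⁻ n : N, ∫⁻ g, ψ₁ g * F g * ψ₂ (g * n) ∂μ ∂ν := by
        refine lintegral_lintegral_swap (Measurable.aemeasurable ?_)
        fun_prop
    _ = ∫⁻ n : N, ∫⁻ g, ψ₁ (g * (n⁻¹ : N)) * F g * ψ₂ g ∂μ ∂ν := by
        refine lintegral_congr fun n => ?_
        rw [← lintegral_mul_left_eq_self _ ((n⁻¹ : N) : G)]
        refine lintegral_congr fun g => ?_
        rw [hFN g _ (n⁻¹).2, hN _ (n⁻¹).2 g, mul_assoc g, ← Subgroup.coe_mul, inv_mul_cancel,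
          Subgroup.coe_one, mul_one]
    _ = ∫⁻ g, ∫⁻ n : N, ψ₁ (g * (n⁻¹ : N)) * F g * ψ₂ g ∂ν ∂μ := by
        refine lintegral_lintegral_swap (Measurable.aemeasurable ?_)
        fun_prop
    _ = ∫⁻ g, ψ₂ g * F g ∂μ := by
        refine lintegral_congr fun g => ?_
        simp_rw [mul_assoc]
        rw [lintegral_mul_const _ (by fun_prop),
          lintegral_inv_eq_self (fun n : N => ψ₁ (g * n)), h₁, one_mul, mul_comm]

/-- The pushforward of a weighted invariant measure along a surjective homomorphism that is
trivial on the central subgroup `N` is invariant: a translate of a weight is again a weight. -/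
theorem isMulLeftInvariant_map_withDensity {N : Subgroup G}
    (hN : ∀ n ∈ N, ∀ g : G, n * g = g * n)
    (ν : Measure N) [SFinite ν] [ν.IsInvInvariant] (μ : Measure G) [SFinite μ]
    [μ.IsMulLeftInvariant] {S : Type*} [Group S] [MeasurableSpace S] [MeasurableMul S]
    {κ : G →* S} (hκ : Measurable κ) (hsurj : Function.Surjective κ) (hker : N ≤ κ.ker)
    {ψ : G → ℝ≥0∞} (hψ : Measurable ψ) (h : ∀ g, ∫⁻ n : N, ψ (g * n) ∂ν = 1) :
    ((μ.withDensity ψ).map κ).IsMulLeftInvariant := by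
  refine ⟨fun s => ?_⟩
  obtain ⟨g, rfl⟩ := hsurj s
  refine Measure.ext_of_lintegral _ fun f hf => ?_
  rw [lintegral_map hf (measurable_const_mul _), lintegral_map (by fun_prop) hκ,
    lintegral_map hf hκ, lintegral_withDensity_eq_lintegral_mul _ hψ (by fun_prop),
    lintegral_withDensity_eq_lintegral_mul _ hψ (by fun_prop)]
  simp only [Pi.mul_apply]
  rw [← lintegral_mul_left_eq_self (fun x => ψ x * f (κ g * κ x)) g⁻¹]
  simp only [map_mul, map_inv, mul_inv_cancel_left]
  refine lintegral_weight_mul_eq hN ν μ (by fun_prop) hψ (by fun_prop)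
    (fun x => by simpa [mul_assoc] using h (g⁻¹ * x)) h fun x n hn => ?_
  rw [map_mul, MonoidHom.mem_ker.1 (hker hn), one_mul]

end Weil

section Weights

open scoped ENNReal

variable {G : Type*} [Group G] [TopologicalSpace G] {N : Subgroup G}

/-- The normalization of a weight as a lower integral. The integral being `1` it is not the value
`0` of the integral of a nonintegrable function. -/
theorem lintegral_ofReal_of_mem_wmbWeights [MeasurableSpace N] [MeasurableMul N] {ν : Measure N}
    [ν.IsMulLeftInvariant] {ψ : G → ℝ} (hψ : ψ ∈ wmbWeights ν) (g : G) :
    ∫⁻ n : N, ENNReal.ofReal (ψ (g * n)) ∂ν = 1 := by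
  obtain ⟨-, -, h0, -, h1⟩ := hψ
  have h := h1 (QuotientGroup.mk g)
  rw [weilMap_mk] at h
  have hi : Integrable (fun n : N => ψ (g * n)) ν := by
    by_contra hi
    rw [integral_undef hi] at h
    exact zero_ne_one h
  rw [← ofReal_integral_eq_lintegral_ofReal hi (Filter.Eventually.of_forall fun _ => h0 _), h,
    ENNReal.ofReal_one]

/-- The formula for the integral over a locally compact group `S` that is the image of `G` under a
homomorphism trivial on the central subgroup `N`: up to the factor `c`, the Haar measure of `S` is
the image of every weighted Haar measure of `G`. -/
theorem exists_integral_eq_integral_weight_mul [IsTopologicalGroup G] [SecondCountableTopology G]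
    [LocallyCompactSpace G] [MeasurableSpace G] [BorelSpace G]
    (hN : ∀ n ∈ N, ∀ g : G, n * g = g * n) {ν : Measure N} [SFinite ν]
    [ν.IsMulLeftInvariant] [ν.IsInvInvariant] (μ : Measure G) [μ.IsHaarMeasure]
    {S : Type*} [Group S] [TopologicalSpace S] [IsTopologicalGroup S]
    [SecondCountableTopology S] [LocallyCompactSpace S] [MeasurableSpace S] [BorelSpace S]
    (μS : Measure S) [μS.IsHaarMeasure] {κ : G →* S} (hκ : Continuous κ)
    (hsurj : Function.Surjective κ) (hker : N ≤ κ.ker) (hne : (wmbWeights ν).Nonempty) :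
    ∃ c : ℝ≥0, c ≠ 0 ∧ ∀ ψ ∈ wmbWeights ν, ∀ φ : S → ℂ, Integrable φ μS →
      Integrable (fun g => (ψ g : ℂ) * φ (κ g)) (c • μ) ∧
      ∫ s, φ s ∂μS = ∫ g, (ψ g : ℂ) * φ (κ g) ∂(c • μ) := by
  have hmeas : ∀ ψ ∈ wmbWeights ν, Measurable fun g => ENNReal.ofReal (ψ g) := fun ψ hψ =>
    hψ.1.measurable.ennreal_ofReal
  obtain ⟨ψ₀, hψ₀⟩ := hne
  -- `m` does not depend on the weight, is left-invariant and finite, so a multiple of `μS`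
  let m : Measure S := (μ.withDensity fun g => ENNReal.ofReal (ψ₀ g)).map κ
  have hm : ∀ ψ ∈ wmbWeights ν, (μ.withDensity fun g => ENNReal.ofReal (ψ g)).map κ = m := by
    intro ψ hψ
    refine Measure.ext_of_lintegral _ fun f hf => ?_
    have hfκ : Measurable fun g => f (κ g) := hf.comp hκ.measurable
    rw [lintegral_map hf hκ.measurable, lintegral_map hf hκ.measurable,
      lintegral_withDensity_eq_lintegral_mul _ (hmeas ψ hψ) hfκ,
      lintegral_withDensity_eq_lintegral_mul _ (hmeas ψ₀ hψ₀) hfκ]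
    refine lintegral_weight_mul_eq hN ν μ (hmeas ψ hψ) (hmeas ψ₀ hψ₀) hfκ
      (lintegral_ofReal_of_mem_wmbWeights hψ) (lintegral_ofReal_of_mem_wmbWeights hψ₀)
      fun x n hn => ?_
    rw [map_mul, MonoidHom.mem_ker.1 (hker hn), one_mul]
  have hminv : m.IsMulLeftInvariant :=
    isMulLeftInvariant_map_withDensity hN ν μ hκ.measurable hsurj hker (hmeas ψ₀ hψ₀)
      (lintegral_ofReal_of_mem_wmbWeights hψ₀)
  obtain ⟨hc, hcs, hnn, hnz, -⟩ := id hψ₀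
  have hint : Integrable ψ₀ μ := hc.integrable_of_hasCompactSupport hcs
  have huniv : m Set.univ = ENNReal.ofReal (∫ g, ψ₀ g ∂μ) := by
    rw [Measure.map_apply hκ.measurable MeasurableSet.univ, Set.preimage_univ,
      withDensity_apply _ MeasurableSet.univ, Measure.restrict_univ,
      ofReal_integral_eq_lintegral_ofReal hint (Filter.Eventually.of_forall hnn)]
  have hfin : IsFiniteMeasure m := ⟨by rw [huniv]; exact ENNReal.ofReal_lt_top⟩
  have hm0 : m ≠ 0 := by
    rw [← Measure.measure_univ_ne_zero, huniv, ne_eq, ENNReal.ofReal_eq_zero, not_le]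
    obtain ⟨g, hg⟩ := Function.ne_iff.1 hnz
    exact hc.integral_pos_of_hasCompactSupport_nonneg_nonzero hcs hnn hg
  obtain ⟨d, hd⟩ : ∃ d : ℝ≥0, m = d • μS := ⟨_, Measure.isMulLeftInvariant_eq_smul m μS⟩
  have hd0 : d ≠ 0 := by
    rintro rfl
    exact hm0 (by rw [hd, zero_smul])
  refine ⟨d⁻¹, inv_ne_zero hd0, fun ψ hψ φ hφ => ?_⟩
  have hμS : (((d⁻¹ : ℝ≥0) • μ).withDensity fun g => ENNReal.ofReal (ψ g)).map κ = μS := by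
    have e : ((d⁻¹ : ℝ≥0) • μ).withDensity (fun g => ENNReal.ofReal (ψ g)) =
        (d⁻¹ : ℝ≥0) • μ.withDensity fun g => ENNReal.ofReal (ψ g) :=
      withDensity_smul_measure _ _
    rw [e, Measure.map_smul, hm ψ hψ, hd, smul_smul, inv_mul_cancel₀ hd0, one_smul]
  have hsmul : ∀ g, (ψ g : ℂ) * φ (κ g) = (ENNReal.ofReal (ψ g)).toReal • φ (κ g) := fun g => by
    rw [ENNReal.toReal_ofReal (hψ.2.2.1 g), Complex.real_smul]
  have hlt : ∀ᵐ g ∂((d⁻¹ : ℝ≥0) • μ), ENNReal.ofReal (ψ g) < ∞ :=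
    Filter.Eventually.of_forall fun _ => ENNReal.ofReal_lt_top
  simp only [hsmul]
  rw [← hμS] at hφ
  constructor
  · rw [← integrable_withDensity_iff_integrable_smul' (hmeas ψ hψ) hlt]
    exact hφ.comp_measurable hκ.measurable
  · rw [← integral_withDensity_eq_integral_toReal_smul (hmeas ψ hψ) hlt,
      ← integral_map hκ.measurable.aemeasurable hφ.aestronglyMeasurable, hμS]

theorem isInvInvariant_of_isHaarMeasure_of_central [IsTopologicalGroup G]
    [SecondCountableTopology G] [LocallyCompactSpace N] [MeasurableSpace G] [BorelSpace G]
    (hN : ∀ n ∈ N, ∀ g : G, n * g = g * n) (ν : Measure N) [ν.IsHaarMeasure] :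
    ν.IsInvInvariant :=
  letI : CommGroup N :=
    { (inferInstance : Group N) with mul_comm := fun x y => Subtype.ext (hN x x.2 y) }
  have : SecondCountableTopology N := Topology.IsEmbedding.subtypeVal.secondCountableTopology
  Measure.IsHaarMeasure.isInvInvariant_of_regular ν

end Weights

/-! ### The formula for the special orthogonal group -/

theorem mainTheorem11 (p : ℕ) [Fact p.Prime] (a b : ℚ_[p]) (hab : IsQuatParam p a b)
    (ν : Measure (scalarPairs p a b)) [ν.IsHaarMeasure]
    (μ₄ : Measure (SO4 p a b)) [μ₄.IsHaarMeasure]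
    (μP : Measure (quatPairs p a b)) [μP.IsHaarMeasure] :
    (wmbWeights ν).Nonempty ∧
    ∃ c : ℝ≥0, c ≠ 0 ∧
      ∀ ψ ∈ wmbWeights ν, ∀ φ : SO4 p a b → ℂ, Integrable φ μ₄ →
        Integrable (wmbLift ψ (φ ∘ kappaBar p a b)) (c • μP) ∧
        ∫ R, φ R ∂μ₄ = ∫ x, wmbLift ψ (φ ∘ kappaBar p a b) x ∂(c • μP) := by
  have := locallyCompactSpace_quatPairs hab
  have : LocallyCompactSpace (scalarPairs p a b) :=
    isClosed_scalarPairs.isClosedEmbedding_subtypeVal.locallyCompactSpace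
  have : SecondCountableTopology (scalarPairs p a b) :=
    Topology.IsEmbedding.subtypeVal.secondCountableTopology
  have hN : ∀ n ∈ scalarPairs p a b, ∀ g : quatPairs p a b, n * g = g * n :=
    fun n hn g => mul_comm_of_mem_scalarPairs hn g
  have := isInvInvariant_of_isHaarMeasure_of_central hN ν
  have hne := wmbWeights_nonempty hab ν
  obtain ⟨c, hc, h⟩ := exists_integral_eq_integral_weight_mul hN μP μ₄ continuous_kappa
    (kappa_surjective hab) (scalarPairs_le_ker p a b) hne
  refine ⟨hne, c, hc, fun ψ hψ φ hφ => ?_⟩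
  have e : wmbLift ψ (φ ∘ kappaBar p a b) = fun g => (ψ g : ℂ) * φ (kappa p a b g) := rfl
  rw [e]
  exact h ψ hψ φ hφ
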